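/- \textbf{Theorem 3 (Dancs–He series for odd zeta-values).} Let $\zeta$ be the Riemann zeta function and let $E_n(x)$ denote the Euler polynomials, defined by $\frac{2e^{xt}}{e^t+1}=\sum_{n\ge 0}E_n(x)\frac{t^n}{n!}$. For every integer $m>0$, the series $\sum_{k\ge 0}(-1)^k\frac{\pi^{2k}E_{2k+1}(1)}{(2k+2m+3)!}$ converges absolutely, and $$\left(1-2^{-2m}\right)\zeta(2m+1)=\sum_{j=1}^{m-1}\frac{(-1)^j\pi^{2j}}{(2j+1)!}\left(2^{2j-2m}-1\right)\zeta(2m-2j+1)-\frac{(-1)^m\pi^{2m}\ln 2}{(2m+1)!}+\frac{(-1)^m\pi^{2m+2}}{2}\sum_{k=0}^{\infty}(-1)^k\frac{\pi^{2k}E_{2k+1}(1)}{(2k+2m+3)!}.$$ -/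

import Mathlib

/-- The Euler polynomials `E_n(x)`, given by the recurrence
`E_n(x) = x ^ n - (1/2) ∑_{k < n} (n choose k) E_k(x)`, which is the comparison of the coefficients
of `t ^ n / n!` in `(e ^ t + 1) ∑ E_n(x) t ^ n / n! = 2 e ^ (x t)`;
see `eulerPolynomial_generating_function`. -/
noncomputable def eulerPolynomial (n : ℕ) : Polynomial ℚ :=
  Polynomial.X ^ n -
    Polynomial.C (1 / 2) * ∑ k : Fin n, (n.choose k : Polynomial ℚ) * eulerPolynomial k
termination_by n
decreasing_by exact k.isLt

/-- The generating function `(e ^ t + 1) ∑ E_n(x) t ^ n / n! = 2 e ^ (x t)` of the Euler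
polynomials, as an identity of power series in `t` over `ℚ[x]`. -/
theorem eulerPolynomial_generating_function :
    (PowerSeries.exp (Polynomial ℚ) + 1) *
        PowerSeries.mk (fun n => Polynomial.C (1 / (n.factorial : ℚ)) * eulerPolynomial n) =
      2 * PowerSeries.rescale (Polynomial.X : Polynomial ℚ) (PowerSeries.exp (Polynomial ℚ)) := by
  ext1 n
  have h2 : (2 : PowerSeries (Polynomial ℚ)) = PowerSeries.C (2 : Polynomial ℚ) :=
    (map_ofNat _ 2).symm
  have hC : (Polynomial.C (1 / 2 : ℚ)) * (2 : Polynomial ℚ) = 1 := by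
    rw [show (2 : Polynomial ℚ) = Polynomial.C 2 from rfl, ← Polynomial.C_mul]
    norm_num
  have hE := eulerPolynomial.eq_1 n
  rw [Finset.sum_fin_eq_sum_range] at hE
  have hs : (∑ i ∈ Finset.range n, if h : i < n then
      ((n.choose ((⟨i, h⟩ : Fin n) : ℕ) : ℕ) : Polynomial ℚ) * eulerPolynomial (⟨i, h⟩ : Fin n) else 0) =
      ∑ i ∈ Finset.range n, (n.choose i : Polynomial ℚ) * eulerPolynomial i :=
    Finset.sum_congr rfl fun i hi => by simp [Finset.mem_range.1 hi]
  rw [hs] at hE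
  have hmul : PowerSeries.coeff n (PowerSeries.exp (Polynomial ℚ) *
      PowerSeries.mk (fun n => Polynomial.C (1 / (n.factorial : ℚ)) * eulerPolynomial n)) =
      Polynomial.C (1 / (n.factorial : ℚ)) *
        ∑ i ∈ Finset.range (n + 1), (n.choose i : Polynomial ℚ) * eulerPolynomial i := by
    rw [mul_comm, PowerSeries.coeff_mul, Finset.Nat.sum_antidiagonal_eq_sum_range_succ_mk,
      Finset.mul_sum]
    refine Finset.sum_congr rfl fun i hi => ?_
    have hi' : i ≤ n := Nat.lt_succ_iff.1 (Finset.mem_range.1 hi)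
    simp only [PowerSeries.coeff_mk, PowerSeries.coeff_exp]
    rw [show (algebraMap ℚ (Polynomial ℚ)) = Polynomial.C from rfl,
      show ((n.choose i : ℕ) : Polynomial ℚ) = Polynomial.C (n.choose i : ℚ) by simp,
      mul_right_comm, ← Polynomial.C_mul, ← mul_assoc, ← Polynomial.C_mul,
      Nat.cast_choose ℚ hi']
    congr 2
    have := Nat.factorial_ne_zero n
    field_simp
  rw [add_mul, one_mul, map_add, hmul, h2, PowerSeries.coeff_C_mul, PowerSeries.coeff_rescale,
    PowerSeries.coeff_exp, PowerSeries.coeff_mk, Finset.sum_range_succ, Nat.choose_self,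
    show (algebraMap ℚ (Polynomial ℚ)) = Polynomial.C from rfl, Nat.cast_one]
  linear_combination (2 * Polynomial.C (1 / (n.factorial : ℚ))) * hE -
    (Polynomial.C (1 / (n.factorial : ℚ)) *
      ∑ i ∈ Finset.range n, (n.choose i : Polynomial ℚ) * eulerPolynomial i) * hC

/-! Both sides evaluate the single integral ∫₀¹ cot(πv/2) v^(2m+1) dv.

Putting z = iπu in 2e^z/(e^z+1) gives 1 + i tan(πu/2), so the numbers E_{2k+1}(1)/(2k+1)! are, up to
sign and powers of π, the Taylor coefficients of tan. Multiplying by (1-u)^(2m+1) and integrating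
termwise, the Beta integral turns 1/(2k+1)! into (2m+1)!/(2k+2m+3)!. Hence the Euler series is that
integral after u = 1-v, divided by π(2m+1)! (`hasSum_eulerPolynomial_integral`).

On the other side, cot(πv/2) is formally 2∑ sin(nπv). The partial sums differ from it by
cos((N+1/2)πv)/sin(πv/2), which the Riemann–Lebesgue lemma removes once v^(2m+1) cancels the pole
(`tendsto_sum_integral_pow_mul_sin`). Repeated integration by parts writes the n-th moment as a
combination of (-1)^(n+1)/(nπ)^(2i+1), 0 ≤ i ≤ m (`integral_odd_pow_mul_sin`). Summing over n yields
the alternating zeta values η(2i+1) = (1-2^(-2i))ζ(2i+1) and η(1) = ln 2. The term i = m is the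
left-hand side of the theorem, and i = 0 is the logarithm. -/

/-! ### Values of Euler polynomials at 1: generating function and growth -/

theorem exp_add_one_mul_mk_eulerPolynomial_eval_one :
    (PowerSeries.exp ℚ + 1) *
        PowerSeries.mk (fun n => (eulerPolynomial n).eval 1 / (n.factorial : ℚ)) =
      2 * PowerSeries.exp ℚ := by
  have h := congrArg (PowerSeries.map (Polynomial.evalRingHom (1 : ℚ)))
    eulerPolynomial_generating_function
  have h1 : PowerSeries.map (Polynomial.evalRingHom (1 : ℚ))
      (PowerSeries.exp (Polynomial ℚ)) = PowerSeries.exp ℚ := by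
    ext n; simp [PowerSeries.coeff_exp]
  have h2 : PowerSeries.map (Polynomial.evalRingHom (1 : ℚ))
      (PowerSeries.rescale (Polynomial.X : Polynomial ℚ) (PowerSeries.exp (Polynomial ℚ))) =
      PowerSeries.exp ℚ := by
    ext n; simp [PowerSeries.coeff_exp, PowerSeries.coeff_rescale]
  have h3 : PowerSeries.map (Polynomial.evalRingHom (1 : ℚ))
      (PowerSeries.mk (fun n => Polynomial.C (1 / (n.factorial : ℚ)) * eulerPolynomial n)) =
      PowerSeries.mk (fun n => (eulerPolynomial n).eval 1 / (n.factorial : ℚ)) := by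
    ext n
    simp only [PowerSeries.coeff_map, PowerSeries.coeff_mk, Polynomial.coe_evalRingHom,
      Polynomial.eval_mul, Polynomial.eval_C]
    ring
  rw [map_mul, map_mul, map_add, h1, h2, h3, map_one, map_ofNat] at h
  exact h

/-- Over the denominator e^(2t)-1 the right side is 2t(e^(2t)+1-(e^t+1))/(e^(2t)-1) = 2te^t/(e^t+1).
Using both Bernoulli conventions puts e^(2t)+1 in the numerator. -/
theorem X_mul_mk_eulerPolynomial_eval_one :
    PowerSeries.X * PowerSeries.mk (fun n => (eulerPolynomial n).eval 1 / (n.factorial : ℚ)) =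
      PowerSeries.rescale 2 (bernoulli'PowerSeries ℚ) +
        PowerSeries.rescale 2 (bernoulliPowerSeries ℚ) - 2 * bernoulliPowerSeries ℚ := by
  have hG := exp_add_one_mul_mk_eulerPolynomial_eval_one
  have hB := bernoulliPowerSeries_mul_exp_sub_one ℚ
  have hB2 := congrArg (PowerSeries.rescale (2 : ℚ)) hB
  have hB2' := congrArg (PowerSeries.rescale (2 : ℚ)) (bernoulli'PowerSeries_mul_exp_sub_one ℚ)
  have he : PowerSeries.rescale (2 : ℚ) (PowerSeries.exp ℚ) = PowerSeries.exp ℚ ^ 2 := by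
    rw [PowerSeries.exp_pow_eq_rescale_exp]; simp
  have hX : PowerSeries.rescale (2 : ℚ) PowerSeries.X = 2 * PowerSeries.X := by
    rw [PowerSeries.rescale_X]; rfl
  simp only [map_mul, map_sub, map_one, he, hX] at hB2 hB2'
  have hne : PowerSeries.exp ℚ ^ 2 - 1 ≠ 0 := by
    intro h0
    rw [h0, mul_zero] at hB2
    have := congrArg (PowerSeries.coeff 1) hB2
    rw [show (2 : PowerSeries ℚ) = PowerSeries.C 2 from (map_ofNat _ 2).symm,
      PowerSeries.coeff_C_mul, PowerSeries.coeff_one_X] at this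
    norm_num at this
  refine mul_right_cancel₀ hne ?_
  linear_combination (PowerSeries.X * (PowerSeries.exp ℚ - 1)) * hG - hB2 - hB2' +
    2 * (PowerSeries.exp ℚ + 1) * hB

theorem eulerPolynomial_eval_one_div_factorial {n : ℕ} (hn : n ≠ 0) :
    (eulerPolynomial n).eval 1 / (n.factorial : ℚ) =
      2 * (2 ^ (n + 1) - 1) * (bernoulli (n + 1) / ((n + 1).factorial : ℚ)) := by
  have h := congrArg (PowerSeries.coeff (n + 1)) X_mul_mk_eulerPolynomial_eval_one
  rw [PowerSeries.coeff_succ_X_mul, PowerSeries.coeff_mk, map_sub, map_add,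
    PowerSeries.coeff_rescale, PowerSeries.coeff_rescale,
    show (2 : PowerSeries ℚ) = PowerSeries.C 2 from (map_ofNat _ 2).symm,
    PowerSeries.coeff_C_mul] at h
  simp only [bernoulli'PowerSeries, bernoulliPowerSeries, PowerSeries.coeff_mk] at h
  rw [← bernoulli_eq_bernoulli'_of_ne_one (by omega)] at h
  simp only [Algebra.algebraMap_self, RingHom.id_apply] at h
  rw [h]
  ring

/-- For n = 2k, Euler's formula gives |B_n|/n! · (2π)^n = 2ζ(2k) ≤ 2ζ(2) = π²/3 < 4; odd n ≥ 3
contribute 0. -/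
theorem abs_bernoulli_div_factorial_le {n : ℕ} (hn : 2 ≤ n) :
    |((bernoulli n : ℚ) : ℝ) / (n.factorial : ℝ)| ≤ 4 / (2 * Real.pi) ^ n := by
  have hpi := Real.pi_pos
  rcases Nat.even_or_odd' n with ⟨k, rfl | rfl⟩
  · have hk : k ≠ 0 := by omega
    have h := hasSum_zeta_nat hk
    have h2 : HasSum (fun n : ℕ => 1 / (n : ℝ) ^ 2) (Real.pi ^ 2 / 6) := hasSum_zeta_two
    have hle : (-1 : ℝ) ^ (k + 1) * 2 ^ (2 * k - 1) * Real.pi ^ (2 * k) *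
        bernoulli (2 * k) / (2 * k).factorial ≤ Real.pi ^ 2 / 6 := by
      refine hasSum_le (fun i => ?_) h h2
      rcases Nat.eq_zero_or_pos i with rfl | hi
      · simp [hk]
      · have : (1 : ℝ) ≤ i := by exact_mod_cast hi
        exact one_div_le_one_div_of_le (by positivity) (pow_le_pow_right₀ this (by omega))
    have hnn : 0 ≤ (-1 : ℝ) ^ (k + 1) * 2 ^ (2 * k - 1) * Real.pi ^ (2 * k) *
        bernoulli (2 * k) / (2 * k).factorial := h.nonneg fun i => by positivity
    rw [le_div_iff₀ (by positivity)]
    have habs : |((bernoulli (2 * k) : ℚ) : ℝ) / ((2 * k).factorial : ℝ)| *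
        (2 * Real.pi) ^ (2 * k) = 2 * ((-1 : ℝ) ^ (k + 1) * 2 ^ (2 * k - 1) * Real.pi ^ (2 * k) *
        bernoulli (2 * k) / (2 * k).factorial) := by
      rw [← abs_of_nonneg hnn, abs_div, abs_div, abs_mul, abs_mul, abs_mul, abs_pow, abs_neg,
        abs_one, one_pow, mul_pow, abs_of_pos (by positivity : (0:ℝ) < 2 ^ (2 * k - 1)),
        abs_of_pos (by positivity : (0:ℝ) < Real.pi ^ (2 * k))]
      obtain ⟨j, rfl⟩ : ∃ j, k = j + 1 := ⟨k - 1, by omega⟩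
      rw [show 2 * (j + 1) - 1 = 2 * j + 1 by omega, show 2 * (j + 1) = 2 * j + 1 + 1 by ring,
        pow_succ (2 : ℝ) (2 * j + 1)]
      ring
    rw [habs]
    nlinarith [Real.pi_lt_d2]
  · rw [bernoulli_eq_zero_of_odd (by simp) (by omega)]
    simp
    positivity

theorem abs_eulerPolynomial_eval_one_div_factorial_le (n : ℕ) :
    |(((eulerPolynomial n).eval 1 : ℚ) : ℝ) / (n.factorial : ℝ)| ≤ 8 / Real.pi ^ n := by
  have hpi := Real.pi_pos
  rcases eq_or_ne n 0 with rfl | hn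
  · rw [eulerPolynomial.eq_1]; simp
  · have h := congrArg (fun q : ℚ => (q : ℝ)) (eulerPolynomial_eval_one_div_factorial hn)
    push_cast at h
    rw [h, abs_mul]
    have hp : (1 : ℝ) ≤ 2 ^ (n + 1) := one_le_pow₀ (by norm_num)
    rw [abs_of_nonneg (by linarith)]
    calc _ ≤ 2 * 2 ^ (n + 1) * (4 / (2 * Real.pi) ^ (n + 1)) := by
          gcongr
          · linarith
          · exact abs_bernoulli_div_factorial_le (by omega)
      _ = 8 / Real.pi ^ n / Real.pi := by
          rw [mul_pow]; field_simp; ring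
      _ ≤ 8 / Real.pi ^ n := div_le_self (by positivity) (by linarith [Real.pi_gt_three])

/-! ### Taylor expansion of the tangent -/

theorem hasSum_eulerPolynomial_eval_one {z : ℂ} (hz : ‖z‖ < Real.pi)
    (hz1 : Complex.exp z + 1 ≠ 0) :
    HasSum (fun n : ℕ => (((eulerPolynomial n).eval 1 : ℚ) : ℂ) / (n.factorial : ℂ) * z ^ n)
      (2 * Complex.exp z / (Complex.exp z + 1)) := by
  have hpi := Real.pi_pos
  set f : ℕ → ℂ := fun n => (((eulerPolynomial n).eval 1 : ℚ) : ℂ) / (n.factorial : ℂ) * z ^ n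
  set g : ℕ → ℂ := fun n => z ^ n / (n.factorial : ℂ)
  have hf : Summable fun n => ‖f n‖ := by
    refine Summable.of_nonneg_of_le (fun _ => norm_nonneg _) (fun n => ?_)
      ((summable_geometric_of_lt_one (by positivity) ((div_lt_one hpi).2 hz)).mul_left 8)
    have := abs_eulerPolynomial_eval_one_div_factorial_le n
    calc ‖f n‖ = |(((eulerPolynomial n).eval 1 : ℚ) : ℝ) / (n.factorial : ℝ)| * ‖z‖ ^ n := by
          simp only [f, norm_mul, norm_pow, norm_div, abs_div]
          congr 2
          · rw [← Complex.ofReal_ratCast, Complex.norm_real, Real.norm_eq_abs]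
          · simp
      _ ≤ 8 / Real.pi ^ n * ‖z‖ ^ n := by gcongr
      _ = _ := by rw [div_pow]; ring
  have hg : Summable fun n => ‖g n‖ := NormedSpace.norm_expSeries_div_summable z
  have hge : HasSum g (Complex.exp z) := by
    rw [Complex.exp_eq_exp_ℂ]; exact NormedSpace.expSeries_div_hasSum_exp z
  have hprod := tsum_mul_tsum_eq_tsum_sum_antidiagonal_of_summable_norm hg hf
  -- The formal identity e^t G = 2e^t - G, read coefficientwise, makes the Cauchy product of the two
  -- absolutely convergent series solvable for ∑ f.
  have hcoef : ∀ n, ∑ kl ∈ Finset.HasAntidiagonal.antidiagonal n, g kl.1 * f kl.2 = 2 * g n - f n := by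
    intro n
    have h := congrArg (PowerSeries.coeff n) exp_add_one_mul_mk_eulerPolynomial_eval_one
    rw [add_mul, one_mul, map_add, PowerSeries.coeff_mul,
      show (2 : PowerSeries ℚ) = PowerSeries.C 2 from (map_ofNat _ 2).symm,
      PowerSeries.coeff_C_mul] at h
    simp only [PowerSeries.coeff_mk, PowerSeries.coeff_exp, Algebra.algebraMap_self,
      RingHom.id_apply] at h
    have h' := congrArg (fun q : ℚ => (q : ℂ)) h
    push_cast at h'
    simp only [f, g]
    have hs : ∑ kl ∈ Finset.HasAntidiagonal.antidiagonal n, z ^ kl.1 / (kl.1.factorial : ℂ) *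
        ((((eulerPolynomial kl.2).eval 1 : ℚ) : ℂ) / (kl.2.factorial : ℂ) * z ^ kl.2) =
        z ^ n * ∑ kl ∈ Finset.HasAntidiagonal.antidiagonal n, 1 / (kl.1.factorial : ℂ) *
        ((((eulerPolynomial kl.2).eval 1 : ℚ) : ℂ) / (kl.2.factorial : ℂ)) := by
      rw [Finset.mul_sum]
      refine Finset.sum_congr rfl fun kl hkl => ?_
      rw [← Finset.HasAntidiagonal.mem_antidiagonal.1 hkl, pow_add]
      ring
    rw [hs]
    linear_combination z ^ n * h'
  rw [tsum_congr hcoef, (hge.summable.mul_left 2).tsum_sub hf.of_norm, tsum_mul_left,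
    hge.tsum_eq] at hprod
  have hval : ∑' n, f n = 2 * Complex.exp z / (Complex.exp z + 1) := by
    rw [eq_div_iff hz1]; linear_combination hprod
  rw [← hval]
  exact hf.of_norm.hasSum

theorem hasSum_eulerPolynomial_eval_one_tan {u : ℝ} (hu : |u| < 1) :
    HasSum (fun k : ℕ => (-1 : ℝ) ^ k * ((((eulerPolynomial (2 * k + 1)).eval 1 : ℚ) : ℝ) /
      ((2 * k + 1).factorial : ℝ)) * (Real.pi * u) ^ (2 * k + 1)) (Real.tan (Real.pi * u / 2)) := by
  have hpi := Real.pi_pos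
  obtain ⟨hu1, hu2⟩ := abs_lt.1 hu
  have hcos : 0 < Real.cos (Real.pi * u / 2) :=
    Real.cos_pos_of_mem_Ioo ⟨by nlinarith, by nlinarith⟩
  have hc : Complex.cos ((Real.pi * u / 2 : ℝ) : ℂ) ≠ 0 := by
    rw [← Complex.ofReal_cos]; exact_mod_cast hcos.ne'
  set z : ℂ := ((Real.pi * u : ℝ) : ℂ) * Complex.I with hz
  set w : ℂ := ((Real.pi * u / 2 : ℝ) : ℂ) with hw
  have hzw : z = w * Complex.I + w * Complex.I := by
    simp only [hz, hw]; push_cast; ring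
  have hexp1 : Complex.exp z + 1 = Complex.exp (w * Complex.I) * (2 * Complex.cos w) := by
    rw [hzw, Complex.exp_add, Complex.two_cos, mul_add, ← Complex.exp_add _ (-w * Complex.I)]
    simp
  have hne : Complex.exp z + 1 ≠ 0 := by
    rw [hexp1]
    exact mul_ne_zero (Complex.exp_ne_zero _) (mul_ne_zero two_ne_zero hc)
  have hnorm : ‖z‖ < Real.pi := by
    rw [hz, norm_mul, Complex.norm_I, mul_one, Complex.norm_real, Real.norm_eq_abs, abs_mul,
      abs_of_pos hpi]
    nlinarith
  have h := hasSum_eulerPolynomial_eval_one hnorm hne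
  have hval : 2 * Complex.exp z / (Complex.exp z + 1) = 1 + Complex.tan w * Complex.I := by
    rw [hexp1, hzw, Complex.exp_add, Complex.tan, Complex.exp_mul_I]
    have : Complex.cos w + Complex.sin w * Complex.I ≠ 0 := by
      rw [← Complex.exp_mul_I]; exact Complex.exp_ne_zero _
    field_simp
  rw [hval] at h
  -- Since z is purely imaginary, its even powers are real, so imaginary parts keep exactly the odd
  -- indices.
  have him := Complex.hasSum_im h
  have hr : (1 + Complex.tan w * Complex.I).im = Real.tan (Real.pi * u / 2) := by
    
    rw [hw, ← Complex.ofReal_tan]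
    simp only [Complex.add_im, Complex.one_im, Complex.mul_I_im, Complex.ofReal_re, zero_add]
  rw [hr] at him
  have hinj : Function.Injective fun k : ℕ => 2 * k + 1 := fun a b hab => by simpa using hab
  have hterm : ∀ n : ℕ, (((((eulerPolynomial n).eval 1 : ℚ) : ℂ) / (n.factorial : ℂ)) * z ^ n).im =
      (((eulerPolynomial n).eval 1 : ℚ) : ℝ) / (n.factorial : ℝ) * (z ^ n).im := fun n => by
    rw [← Complex.im_ofReal_mul]; push_cast; rfl
  have hsq : z ^ 2 = ((-(Real.pi * u) ^ 2 : ℝ) : ℂ) := by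
    rw [hz, mul_pow, Complex.I_sq]; push_cast; ring
  simp only [hterm] at him
  rw [← hinj.hasSum_iff] at him
  · convert! him using 2 with k
    have hpow : (z ^ (2 * k + 1)).im = (-1) ^ k * (Real.pi * u) ^ (2 * k + 1) := by
      rw [pow_succ, pow_mul, hsq, ← Complex.ofReal_pow, Complex.im_ofReal_mul, hz,
        Complex.mul_I_im, Complex.ofReal_re, neg_pow]
      ring
    rw [Function.comp_apply, hpow]
    ring
  · intro n hn
    rcases Nat.even_or_odd' n with ⟨k, rfl | rfl⟩
    · rw [pow_mul, hsq, ← Complex.ofReal_pow, Complex.ofReal_im, mul_zero]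
    · exact absurd ⟨k, rfl⟩ hn

/-! ### Beta integrals and termwise integration -/

theorem integral_pow_mul_one_sub_pow (a b : ℕ) :
    ∫ u in (0 : ℝ)..1, u ^ a * (1 - u) ^ b =
      (a.factorial * b.factorial : ℝ) / ((a + b + 1).factorial : ℝ) := by
  induction b generalizing a with
  | zero =>
    simp only [pow_zero, mul_one, integral_pow, add_zero, Nat.factorial_succ]
    have := Nat.factorial_ne_zero a
    push_cast
    field_simp
    simp
  | succ b ih =>
    -- This function vanishes at 0 and 1, so integrating its derivative trades one factor 1-u for
    -- one factor u.
    have hderiv : ∀ u : ℝ, HasDerivAt (fun u : ℝ => u ^ (a + 1) * (1 - u) ^ (b + 1))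
        ((a + 1) * (u ^ a * (1 - u) ^ (b + 1)) - (b + 1) * (u ^ (a + 1) * (1 - u) ^ b)) u := by
      intro u
      convert! (hasDerivAt_pow (a + 1) u).mul
        (((hasDerivAt_id u).const_sub 1).pow (b + 1)) using 1
      simp
      ring
    have h := intervalIntegral.integral_eq_sub_of_hasDerivAt (a := 0) (b := 1)
      (fun u _ => hderiv u) (Continuous.intervalIntegrable (by fun_prop) _ _)
    rw [intervalIntegral.integral_sub (Continuous.intervalIntegrable (by fun_prop) _ _)
      (Continuous.intervalIntegrable (by fun_prop) _ _), intervalIntegral.integral_const_mul,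
      intervalIntegral.integral_const_mul, ih (a + 1)] at h
    simp only [sub_self, ne_eq, Nat.succ_ne_zero, not_false_eq_true, zero_pow, mul_zero, zero_mul,
      sub_zero] at h
    rw [show a + 1 + b + 1 = a + (b + 1) + 1 by ring] at h
    have ha : (a : ℝ) + 1 ≠ 0 := by positivity
    apply mul_left_cancel₀ ha
    rw [sub_eq_zero.1 h, Nat.factorial_succ a, Nat.factorial_succ b]
    push_cast
    ring

theorem abs_eulerPolynomial_coeff_le (k : ℕ) :
    |(-1 : ℝ) ^ k * (Real.pi ^ (2 * k) * (((eulerPolynomial (2 * k + 1)).eval 1 : ℚ) : ℝ)) /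
      ((2 * k + 1).factorial : ℝ)| ≤ 8 := by
  have hpi := Real.pi_pos
  have h := abs_eulerPolynomial_eval_one_div_factorial_le (2 * k + 1)
  rw [mul_div_assoc, mul_div_assoc, abs_mul, abs_pow, abs_neg, abs_one, one_pow, one_mul, abs_mul,
    abs_of_pos (by positivity : 0 < Real.pi ^ (2 * k))]
  calc _ ≤ Real.pi ^ (2 * k) * (8 / Real.pi ^ (2 * k + 1)) := by gcongr
    _ = 8 / Real.pi := by rw [pow_succ]; field_simp
    _ ≤ 8 := div_le_self (by norm_num) (by linarith [Real.pi_gt_three])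

theorem factorial_div_factorial_le_one_div_sq (k m : ℕ) :
    ((2 * k + 1).factorial : ℝ) / ((2 * k + 2 * m + 3).factorial : ℝ) ≤ 1 / ((k : ℝ) + 1) ^ 2 := by
  have h1 : ((2 * k + 3).factorial : ℝ) ≤ ((2 * k + 2 * m + 3).factorial : ℝ) := by
    exact_mod_cast Nat.factorial_le (by omega)
  have h2 : ((2 * k + 3).factorial : ℝ) =
      (2 * k + 3) * ((2 * k + 2) * ((2 * k + 1).factorial : ℝ)) := by
    rw [Nat.factorial_succ, Nat.factorial_succ]; push_cast; ring
  have h3 : (0 : ℝ) < (2 * k + 1).factorial := by positivity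
  rw [div_le_div_iff₀ (by positivity) (by positivity), one_mul]
  refine le_trans ?_ h1
  rw [h2, mul_comm, ← mul_assoc]
  gcongr
  nlinarith [(Nat.cast_nonneg k : (0 : ℝ) ≤ k)]

theorem summable_eulerPolynomial_div_factorial (m : ℕ) :
    Summable (fun k : ℕ => |(-1 : ℝ) ^ k * (Real.pi ^ (2 * k) *
      (((eulerPolynomial (2 * k + 1)).eval 1 : ℚ) : ℝ)) / ((2 * k + 2 * m + 3).factorial : ℝ)|) := by
  have hs : Summable fun k : ℕ => 8 * (1 / ((k : ℝ) + 1) ^ 2) := by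
    refine Summable.mul_left 8 ?_
    have := (summable_nat_add_iff 1).2 (Real.summable_one_div_nat_pow.2 one_lt_two)
    simpa using this
  refine Summable.of_nonneg_of_le (fun _ => abs_nonneg _) (fun k => ?_) hs
  have h3 : ((2 * k + 1).factorial : ℝ) ≠ 0 := by positivity
  calc _ = |(-1 : ℝ) ^ k * (Real.pi ^ (2 * k) *
      (((eulerPolynomial (2 * k + 1)).eval 1 : ℚ) : ℝ)) / ((2 * k + 1).factorial : ℝ)| *
      (((2 * k + 1).factorial : ℝ) / ((2 * k + 2 * m + 3).factorial : ℝ)) := by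
        rw [abs_div, abs_div, Nat.abs_cast, Nat.abs_cast]
        field_simp
    _ ≤ _ := by
        exact mul_le_mul (abs_eulerPolynomial_coeff_le k)
          (factorial_div_factorial_le_one_div_sq k m) (by positivity) (by norm_num)

/-- The Beta kernel is nonnegative on [0,1], so the L¹ norms of the terms are the absolute values of
the series terms; their summability justifies the interchange. -/
theorem hasSum_eulerPolynomial_integral (m : ℕ) :
    HasSum (fun k : ℕ => (-1 : ℝ) ^ k * (Real.pi ^ (2 * k) *
      (((eulerPolynomial (2 * k + 1)).eval 1 : ℚ) : ℝ)) / ((2 * k + 2 * m + 3).factorial : ℝ))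
      ((∫ u in (0 : ℝ)..1, Real.tan (Real.pi * u / 2) * (1 - u) ^ (2 * m + 1)) /
        (Real.pi * ((2 * m + 1).factorial : ℝ))) := by
  have hpi := Real.pi_pos
  set c : ℕ → ℝ := fun k => (-1 : ℝ) ^ k * (Real.pi ^ (2 * k) *
      (((eulerPolynomial (2 * k + 1)).eval 1 : ℚ) : ℝ))
  let w : ℕ → ℝ := fun k => c k / ((2 * k + 1).factorial * (2 * m + 1).factorial)
  let F : ℕ → ℝ → ℝ := fun k u => w k * (u ^ (2 * k + 1) * (1 - u) ^ (2 * m + 1))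
  have hbeta : ∀ k, w k * ∫ u in (0 : ℝ)..1, u ^ (2 * k + 1) * (1 - u) ^ (2 * m + 1) =
      c k / ((2 * k + 2 * m + 3).factorial : ℝ) := fun k => by
    rw [integral_pow_mul_one_sub_pow, show 2 * k + 1 + (2 * m + 1) + 1 = 2 * k + 2 * m + 3 by ring]
    have h1 := Nat.factorial_ne_zero (2 * k + 1)
    have h2 := Nat.factorial_ne_zero (2 * m + 1)
    simp only [w]
    field_simp
  have hF : ∀ k, ∫ u in Set.Ioc (0 : ℝ) 1, F k u = c k / ((2 * k + 2 * m + 3).factorial : ℝ) := by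
    intro k
    rw [← intervalIntegral.integral_of_le zero_le_one, intervalIntegral.integral_const_mul, hbeta]
  have hFn : ∀ k, ∫ u in Set.Ioc (0 : ℝ) 1, ‖F k u‖ =
      |c k / ((2 * k + 2 * m + 3).factorial : ℝ)| := by
    intro k
    have hn : ∫ u in Set.Ioc (0 : ℝ) 1, ‖F k u‖ =
        ∫ u in Set.Ioc (0 : ℝ) 1, |w k| * (u ^ (2 * k + 1) * (1 - u) ^ (2 * m + 1)) := by
      refine MeasureTheory.setIntegral_congr_fun measurableSet_Ioc fun u hu => ?_
      have h1 : 0 ≤ 1 - u := by linarith [hu.2]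
      have h0 : 0 ≤ u := hu.1.le
      simp only [F, norm_mul, Real.norm_eq_abs]
      rw [abs_of_nonneg (pow_nonneg h0 _), abs_of_nonneg (pow_nonneg h1 _)]
    rw [hn, ← intervalIntegral.integral_of_le zero_le_one, intervalIntegral.integral_const_mul,
      ← hbeta k, abs_mul, abs_of_nonneg (a := ∫ u in (0 : ℝ)..1, _)]
    rw [integral_pow_mul_one_sub_pow]
    positivity
  have h := MeasureTheory.hasSum_integral_of_summable_integral_norm
    (μ := MeasureTheory.volume.restrict (Set.Ioc (0 : ℝ) 1)) (F := F)
    (fun k => (Continuous.integrableOn_Ioc (by fun_prop)))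
    (by simp only [hFn]; exact summable_eulerPolynomial_div_factorial m)
  simp only [hF] at h
  convert! h using 1
  -- The endpoint u = 1, where the tangent has its pole, is discarded as a null set.
  rw [← intervalIntegral.integral_div, intervalIntegral.integral_of_le zero_le_one,
    MeasureTheory.integral_Ioc_eq_integral_Ioo, MeasureTheory.integral_Ioc_eq_integral_Ioo]
  refine MeasureTheory.setIntegral_congr_fun measurableSet_Ioo fun u hu => ?_
  have ht := hasSum_eulerPolynomial_eval_one_tan (u := u) (by rw [abs_of_pos hu.1]; exact hu.2)
  have ht' := ht.mul_right ((1 - u) ^ (2 * m + 1) / (Real.pi * ((2 * m + 1).factorial : ℝ)))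
  rw [mul_div_assoc, ← ht'.tsum_eq]
  refine tsum_congr fun k => ?_
  simp only [F, w, c]
  have h1 := Nat.factorial_ne_zero (2 * k + 1)
  have h2 := Nat.factorial_ne_zero (2 * m + 1)
  rw [mul_pow, pow_succ Real.pi]
  field_simp

/-! ### Cotangent moments through sine sums -/

theorem integral_tan_mul_one_sub_pow (p : ℕ) :
    ∫ u in (0 : ℝ)..1, Real.tan (Real.pi * u / 2) * (1 - u) ^ p =
      ∫ v in (0 : ℝ)..1, Real.cos (Real.pi * v / 2) / Real.sin (Real.pi * v / 2) * v ^ p := by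
  have h := intervalIntegral.integral_comp_sub_left (a := 0) (b := 1)
    (fun u : ℝ => Real.tan (Real.pi * u / 2) * (1 - u) ^ p) 1
  simp only [sub_self, sub_zero] at h
  rw [← h]
  refine intervalIntegral.integral_congr fun v _ => ?_
  simp only [sub_sub_cancel]
  rw [show Real.pi * (1 - v) / 2 = Real.pi / 2 - Real.pi * v / 2 by ring, Real.tan_eq_sin_div_cos,
    Real.sin_pi_div_two_sub, Real.cos_pi_div_two_sub]

theorem two_mul_sum_sin_mul_sin_half (x : ℝ) (N : ℕ) :
    (2 * ∑ n ∈ Finset.range N, Real.sin ((n + 1) * x)) * Real.sin (x / 2) =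
      Real.cos (x / 2) - Real.cos ((N + 1 / 2) * x) := by
  induction N with
  | zero => simp [show (2 : ℝ)⁻¹ * x = x / 2 by ring]
  | succ N ih =>
    rw [Finset.sum_range_succ, mul_add, add_mul, ih]
    have h1 : ((N : ℝ) + 1 / 2) * x = (N + 1) * x - x / 2 := by ring
    have h2 : (((N + 1 : ℕ) : ℝ) + 1 / 2) * x = (N + 1) * x + x / 2 := by push_cast; ring
    rw [h1, h2, Real.cos_sub, Real.cos_add]
    ring

/-- The Riemann–Lebesgue lemma for g extended by zero, after taking real parts. The Fourier
character carries a factor 2π, hence the frequency (N+1/2)/2. -/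
theorem tendsto_integral_cos_mul {g : ℝ → ℝ}
    (hg : MeasureTheory.IntegrableOn g (Set.Ioc 0 1)) :
    Filter.Tendsto (fun N : ℕ => ∫ v in (0 : ℝ)..1, Real.cos ((N + 1 / 2) * (Real.pi * v)) * g v)
      Filter.atTop (nhds 0) := by
  have h := Real.tendsto_integral_exp_smul_cocompact
    ((Set.Ioc (0 : ℝ) 1).indicator fun v => (g v : ℂ))
  have hw : Filter.Tendsto (fun N : ℕ => ((N : ℝ) + 1 / 2) / 2) Filter.atTop
      (Filter.cocompact ℝ) :=
    (((tendsto_natCast_atTop_atTop.atTop_add tendsto_const_nhds).atTop_div_const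
      two_pos)).mono_right atTop_le_cocompact
  have h2 := (Complex.continuous_re.tendsto 0).comp (h.comp hw)
  rw [Complex.zero_re] at h2
  refine h2.congr fun N => ?_
  simp only [Function.comp_apply]
  have hind : ∀ w v : ℝ, Real.fourierChar (-(v * w)) •
      (Set.Ioc (0 : ℝ) 1).indicator (fun v => (g v : ℂ)) v =
      (Set.Ioc (0 : ℝ) 1).indicator (fun v => Real.fourierChar (-(v * w)) • (g v : ℂ)) v := by
    intro w v
    by_cases hv : v ∈ Set.Ioc (0 : ℝ) 1 <;> simp [hv]
  simp only [hind]
  rw [MeasureTheory.integral_indicator measurableSet_Ioc,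
    intervalIntegral.integral_of_le zero_le_one]
  have hint : MeasureTheory.Integrable (fun v : ℝ =>
      Real.fourierChar (-(v * (((N : ℝ) + 1 / 2) / 2))) • (g v : ℂ))
      (MeasureTheory.volume.restrict (Set.Ioc 0 1)) := by
    have := (Real.fourierIntegral_convergent_iff
      (μ := MeasureTheory.volume.restrict (Set.Ioc (0 : ℝ) 1)) (f := fun v => (g v : ℂ))
      (((N : ℝ) + 1 / 2) / 2)).2 (MeasureTheory.Integrable.ofReal hg)
    simpa [mul_comm] using this
  rw [← RCLike.re_eq_complex_re, ← integral_re hint]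
  refine MeasureTheory.setIntegral_congr_fun measurableSet_Ioc fun v _ => ?_
  simp only [RCLike.re_eq_complex_re, Circle.smul_def, smul_eq_mul, Real.fourierChar_apply,
    Complex.re_mul_ofReal, Complex.exp_ofReal_mul_I_re]
  rw [← Real.cos_neg]
  congr 2
  ring

theorem integral_pow_mul_sin_add_two (p : ℕ) {x : ℝ} (hx : x ≠ 0) :
    ∫ v in (0 : ℝ)..1, v ^ (p + 2) * Real.sin (x * v) =
      -Real.cos x / x + (p + 2) * Real.sin x / x ^ 2 -
        (p + 2) * (p + 1) / x ^ 2 * ∫ v in (0 : ℝ)..1, v ^ p * Real.sin (x * v) := by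
  -- Boundary terms of two integrations by parts, gathered into one antiderivative.
  have hd : ∀ v : ℝ, HasDerivAt (fun v : ℝ => -(v ^ (p + 2) * Real.cos (x * v)) / x +
      (p + 2) * (v ^ (p + 1) * Real.sin (x * v)) / x ^ 2)
      (v ^ (p + 2) * Real.sin (x * v) +
        (p + 2) * (p + 1) / x ^ 2 * (v ^ p * Real.sin (x * v))) v := by
    intro v
    have hxv : HasDerivAt (fun v : ℝ => x * v) x v := by
      simpa using (hasDerivAt_id v).const_mul x
    convert! (((hasDerivAt_pow (p + 2) v).mul hxv.cos).neg.div_const x).add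
      ((((hasDerivAt_pow (p + 1) v).mul hxv.sin).const_mul ((p : ℝ) + 2)).div_const (x ^ 2)) using 1
    simp
    field_simp
    ring
  have h := intervalIntegral.integral_eq_sub_of_hasDerivAt (a := 0) (b := 1)
    (fun u _ => hd u) (Continuous.intervalIntegrable (by fun_prop) _ _)
  rw [intervalIntegral.integral_add (Continuous.intervalIntegrable (by fun_prop) _ _)
    (Continuous.intervalIntegrable (by fun_prop) _ _), intervalIntegral.integral_const_mul] at h
  simp at h
  linear_combination h

theorem integral_mul_sin {x : ℝ} (hx : x ≠ 0) :
    ∫ v in (0 : ℝ)..1, v * Real.sin (x * v) = -Real.cos x / x + Real.sin x / x ^ 2 := by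
  have hd : ∀ v : ℝ, HasDerivAt (fun v : ℝ => -(v * Real.cos (x * v)) / x +
      Real.sin (x * v) / x ^ 2) (v * Real.sin (x * v)) v := by
    intro v
    have hxv : HasDerivAt (fun v : ℝ => x * v) x v := by
      simpa using (hasDerivAt_id v).const_mul x
    convert! (((hasDerivAt_id v).mul hxv.cos).neg.div_const x).add
      (hxv.sin.div_const (x ^ 2)) using 1
    simp
    field_simp
    ring
  have h := intervalIntegral.integral_eq_sub_of_hasDerivAt (a := 0) (b := 1)
    (fun u _ => hd u) (Continuous.intervalIntegrable (by fun_prop) _ _)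
  simpa using h

/-- Induction by the two-step reduction formula at x = nπ, where the sine boundary term vanishes:
each step multiplies the old sum by -1/(nπ)² and the factorial ratio, and adds the term j = m+1. -/
theorem integral_odd_pow_mul_sin (m n : ℕ) (hn : n ≠ 0) :
    ∫ v in (0 : ℝ)..1, v ^ (2 * m + 1) * Real.sin (n * Real.pi * v) =
      ((2 * m + 1).factorial : ℝ) * ∑ j ∈ Finset.range (m + 1),
        (-1) ^ (m - j) / ((2 * j + 1).factorial : ℝ) *
          ((-1) ^ (n + 1) / (n * Real.pi) ^ (2 * (m - j) + 1)) := by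
  have hpi := Real.pi_pos
  have hx : (n : ℝ) * Real.pi ≠ 0 := by positivity
  induction m with
  | zero =>
    simp only [mul_zero, zero_add, pow_one, integral_mul_sin hx, Real.sin_nat_mul_pi,
      Real.cos_nat_mul_pi]
    simp [pow_succ]
  | succ m ih =>
    rw [show 2 * (m + 1) + 1 = (2 * m + 1) + 2 by ring, integral_pow_mul_sin_add_two _ hx, ih,
      Finset.sum_range_succ _ (m + 1), Real.sin_nat_mul_pi, Real.cos_nat_mul_pi]
    have hs : ∑ j ∈ Finset.range (m + 1), (-1 : ℝ) ^ (m + 1 - j) / ((2 * j + 1).factorial : ℝ) *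
          ((-1) ^ (n + 1) / (n * Real.pi) ^ (2 * (m + 1 - j) + 1)) =
        -(1 / (n * Real.pi) ^ 2) * ∑ j ∈ Finset.range (m + 1),
        (-1 : ℝ) ^ (m - j) / ((2 * j + 1).factorial : ℝ) *
          ((-1) ^ (n + 1) / (n * Real.pi) ^ (2 * (m - j) + 1)) := by
      rw [Finset.mul_sum]
      refine Finset.sum_congr rfl fun j hj => ?_
      rw [Nat.succ_sub (Nat.lt_succ_iff.1 (Finset.mem_range.1 hj)), pow_succ (-1 : ℝ) (m - j),
        show 2 * (m - j).succ + 1 = (2 * (m - j) + 1) + 2 by rw [Nat.succ_eq_add_one]; ring,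
        pow_add _ _ 2]
      field_simp
    rw [hs]
    have hf : ((2 * m + 1 + 2).factorial : ℝ) =
        (2 * m + 3) * ((2 * m + 2) * ((2 * m + 1).factorial : ℝ)) := by
      rw [Nat.factorial_succ, Nat.factorial_succ]; push_cast; ring
    have hf0 : ((2 * m + 1).factorial : ℝ) ≠ 0 := by positivity
    have hf1 : ((2 * m + 1 + 2).factorial : ℝ) ≠ 0 := by positivity
    rw [Nat.sub_self, show 2 * (m + 1) + 1 = 2 * m + 1 + 2 by ring, mul_add, hf]
    push_cast
    simp only [mul_zero, pow_one, pow_zero, pow_succ (-1 : ℝ) n]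
    have h3 : (2 * (m : ℝ) + 3) ≠ 0 := by positivity
    field_simp
    ring

/-- Jordan's inequality sin(πv/2) ≥ v bounds the quotient by 1. -/
theorem integrableOn_pow_div_sin (p : ℕ) :
    MeasureTheory.IntegrableOn (fun v : ℝ => v ^ (p + 1) / Real.sin (Real.pi * v / 2))
      (Set.Ioc 0 1) := by
  refine MeasureTheory.Measure.integrableOn_of_bounded (M := 1) (by simp)
    (Measurable.aestronglyMeasurable (by fun_prop)) ?_
  refine (MeasureTheory.ae_restrict_mem measurableSet_Ioc).mono fun v hv => ?_
  have hpi := Real.pi_pos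
  have hs : v ≤ Real.sin (Real.pi * v / 2) := by
    have := Real.mul_le_sin (x := Real.pi * v / 2) (by nlinarith [hv.1]) (by nlinarith [hv.2])
    convert! this using 1
    field_simp
  have hs0 : 0 < Real.sin (Real.pi * v / 2) := hv.1.trans_le hs
  rw [Real.norm_eq_abs, abs_of_nonneg (div_nonneg (pow_nonneg hv.1.le _) hs0.le), div_le_one hs0]
  refine le_trans ?_ hs
  exact pow_le_of_le_one hv.1.le hv.2 (by omega)

theorem tendsto_sum_integral_pow_mul_sin (p : ℕ) :
    Filter.Tendsto (fun N : ℕ => 2 * ∑ n ∈ Finset.range N,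
      ∫ v in (0 : ℝ)..1, v ^ (p + 1) * Real.sin (((n + 1 : ℕ) : ℝ) * Real.pi * v)) Filter.atTop
      (nhds (∫ v in (0 : ℝ)..1,
        Real.cos (Real.pi * v / 2) / Real.sin (Real.pi * v / 2) * v ^ (p + 1))) := by
  have hpi := Real.pi_pos
  have hg := integrableOn_pow_div_sin p
  have hgi : IntervalIntegrable (fun v : ℝ => v ^ (p + 1) / Real.sin (Real.pi * v / 2))
      MeasureTheory.volume 0 1 :=
    (intervalIntegrable_iff_integrableOn_Ioc_of_le zero_le_one).2 hg
  have h := (tendsto_integral_cos_mul hg).const_sub (∫ v in (0 : ℝ)..1,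
        Real.cos (Real.pi * v / 2) / Real.sin (Real.pi * v / 2) * v ^ (p + 1))
  rw [sub_zero] at h
  refine h.congr fun N => ?_
  have hci : ∀ f : ℝ → ℝ, Continuous f → IntervalIntegrable
      (fun v => f v * (v ^ (p + 1) / Real.sin (Real.pi * v / 2))) MeasureTheory.volume 0 1 :=
    fun f hf => hgi.continuousOn_mul hf.continuousOn
  have h1 : IntervalIntegrable (fun v : ℝ => Real.cos (Real.pi * v / 2) /
      Real.sin (Real.pi * v / 2) * v ^ (p + 1)) MeasureTheory.volume 0 1 := by
    refine (hci (fun v => Real.cos (Real.pi * v / 2)) (by fun_prop)).congr fun v _ => ?_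
    ring
  rw [← intervalIntegral.integral_sub h1 (hci (fun v => Real.cos ((N + 1 / 2) * (Real.pi * v)))
    (by fun_prop)), ← intervalIntegral.integral_finsetSum
    (fun n _ => Continuous.intervalIntegrable (by fun_prop) _ _),
    ← intervalIntegral.integral_const_mul, intervalIntegral.integral_of_le zero_le_one,
    intervalIntegral.integral_of_le zero_le_one]
  refine MeasureTheory.setIntegral_congr_fun measurableSet_Ioc fun v hv => ?_
  have hs : Real.sin (Real.pi * v / 2) ≠ 0 :=
    (Real.sin_pos_of_pos_of_lt_pi (by nlinarith [hv.1]) (by nlinarith [hv.2])).ne'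
  have hD := two_mul_sum_sin_mul_sin_half (Real.pi * v) N
  have hsum : ∑ n ∈ Finset.range N, v ^ (p + 1) * Real.sin (((n + 1 : ℕ) : ℝ) * Real.pi * v) =
      v ^ (p + 1) * ∑ n ∈ Finset.range N, Real.sin ((n + 1) * (Real.pi * v)) := by
    rw [Finset.mul_sum]
    refine Finset.sum_congr rfl fun n _ => ?_
    push_cast
    rw [mul_assoc]
  simp only [hsum]
  rw [div_mul_eq_mul_div, ← mul_div_assoc, ← sub_div, div_eq_iff hs]
  linear_combination -v ^ (p + 1) * hD

/-! ### Alternating zeta values -/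

/-- The partial sum is H_{2K} - H_K, and H_n - ln n converges, so the Euler constant cancels and ln
2K - ln K = ln 2 remains. -/
theorem tendsto_sum_neg_one_pow_div_log_two :
    Filter.Tendsto (fun K : ℕ => ∑ n ∈ Finset.range (2 * K), (-1 : ℝ) ^ n / ((n : ℝ) + 1))
      Filter.atTop (nhds (Real.log 2)) := by
  have hsum : ∀ K : ℕ, ∑ n ∈ Finset.range (2 * K), (-1 : ℝ) ^ n / ((n : ℝ) + 1) =
      (harmonic (2 * K) : ℝ) - harmonic K := by
    intro K
    induction K with
    | zero => simp
    | succ K ih =>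
      rw [show 2 * (K + 1) = 2 * K + 1 + 1 by ring, Finset.sum_range_succ, Finset.sum_range_succ,
        ih, harmonic_succ, harmonic_succ, harmonic_succ, pow_succ, pow_mul]
      push_cast
      have : (K : ℝ) + 1 ≠ 0 := by positivity
      have : 2 * (K : ℝ) + 1 + 1 ≠ 0 := by positivity
      field_simp
      ring
  have h := Real.tendsto_harmonic_sub_log
  have h2 : Filter.Tendsto (fun K : ℕ => 2 * K) Filter.atTop Filter.atTop :=
    Filter.tendsto_id.const_mul_atTop' two_pos
  have h3 := ((h.comp h2).sub h).add_const (Real.log 2)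
  rw [sub_self, zero_add] at h3
  refine h3.congr' ?_
  filter_upwards [Filter.eventually_gt_atTop 0] with K hK
  rw [hsum]
  have : (K : ℝ) ≠ 0 := by positivity
  simp only [Function.comp_apply]
  push_cast
  rw [Real.log_mul two_ne_zero this]
  ring

theorem hasSum_neg_one_pow_div_pow {q : ℕ} (hq : 1 < q) :
    HasSum (fun n : ℕ => (-1 : ℝ) ^ n / ((n : ℝ) + 1) ^ q)
      ((1 - 2 / 2 ^ q) * ∑' n : ℕ, 1 / ((n : ℝ) + 1) ^ q) := by
  have hs : Summable fun n : ℕ => 1 / ((n : ℝ) + 1) ^ q := by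
    simpa using (summable_nat_add_iff 1).2 (Real.summable_one_div_nat_pow.2 hq)
  -- The difference between ζ(q) and η(q) lives on odd n, where n+1 = 2(k+1).
  have hodd : HasSum (fun n : ℕ => (1 - (-1 : ℝ) ^ n) / ((n : ℝ) + 1) ^ q)
      (0 + 2 / 2 ^ q * ∑' n : ℕ, 1 / ((n : ℝ) + 1) ^ q) := by
    refine HasSum.even_add_odd ?_ ?_
    · simp [pow_mul]
    · convert! hs.hasSum.mul_left (2 / 2 ^ q) using 2 with k
      rw [pow_succ, pow_mul]
      push_cast
      rw [show 2 * (k : ℝ) + 1 + 1 = 2 * (k + 1) by ring, mul_pow]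
      have : (k : ℝ) + 1 ≠ 0 := by positivity
      field_simp
      norm_num
  convert! hs.hasSum.sub hodd using 1
  · ext n; ring
  · ring

theorem riemannZeta_natCast_eq_ofReal_tsum {q : ℕ} (hq : 1 < q) :
    riemannZeta q = ((∑' n : ℕ, 1 / ((n : ℝ) + 1) ^ q : ℝ) : ℂ) := by
  have hs : Summable fun n : ℕ => 1 / (n : ℂ) ^ q := by
    simpa using Complex.ofRealCLM.summable (Real.summable_one_div_nat_pow.2 hq)
  rw [zeta_nat_eq_tsum_of_gt_one hq, Complex.ofReal_tsum, hs.tsum_eq_zero_add]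
  have : q ≠ 0 := by omega
  simp [this]

/-! ### Comparison of the two evaluations -/

/-- Limits along even partial sums suffice, which treats the conditionally convergent case i = 0
together with the absolutely convergent ones. -/
theorem integral_cot_eq_sum (m : ℕ) {L : ℕ → ℝ}
    (hL : ∀ i, Filter.Tendsto (fun K : ℕ => ∑ n ∈ Finset.range (2 * K),
      (-1 : ℝ) ^ n / ((n : ℝ) + 1) ^ (2 * i + 1)) Filter.atTop (nhds (L i))) :
    ∫ v in (0 : ℝ)..1, Real.cos (Real.pi * v / 2) / Real.sin (Real.pi * v / 2) * v ^ (2 * m + 1) =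
      2 * ((2 * m + 1).factorial * ∑ j ∈ Finset.range (m + 1),
        (-1) ^ (m - j) / ((2 * j + 1).factorial * Real.pi ^ (2 * (m - j) + 1)) * L (m - j)) := by
  have h2 : Filter.Tendsto (fun K : ℕ => 2 * K) Filter.atTop Filter.atTop :=
    Filter.tendsto_id.const_mul_atTop' two_pos
  have h := (tendsto_sum_integral_pow_mul_sin (2 * m)).comp h2
  refine tendsto_nhds_unique h ?_
  have hlim := ((tendsto_finsetSum (Finset.range (m + 1)) fun j _ => (hL (m - j)).const_mul
    ((-1 : ℝ) ^ (m - j) / ((2 * j + 1).factorial * Real.pi ^ (2 * (m - j) + 1)))).const_mul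
    ((2 * m + 1).factorial : ℝ)).const_mul 2
  refine hlim.congr fun K => ?_
  simp only [Function.comp_apply]
  congr 1
  simp only [Finset.mul_sum]
  rw [Finset.sum_comm]
  refine Finset.sum_congr rfl fun n _ => ?_
  rw [integral_odd_pow_mul_sin m (n + 1) (by omega), Finset.mul_sum]
  refine Finset.sum_congr rfl fun j _ => ?_
  have hpi := Real.pi_ne_zero
  push_cast
  rw [mul_pow]
  have : (n : ℝ) + 1 ≠ 0 := by positivity
  field_simp
  ring

theorem sum_alternatingZeta_eq_tsum_eulerPolynomial (m : ℕ) {L : ℕ → ℝ}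
    (hL : ∀ i, Filter.Tendsto (fun K : ℕ => ∑ n ∈ Finset.range (2 * K),
      (-1 : ℝ) ^ n / ((n : ℝ) + 1) ^ (2 * i + 1)) Filter.atTop (nhds (L i))) :
    ∑ j ∈ Finset.range (m + 1),
        (-1) ^ j * Real.pi ^ (2 * j) / ((2 * j + 1).factorial : ℝ) * L (m - j) =
      (-1) ^ m * Real.pi ^ (2 * m + 2) / 2 *
        ∑' k : ℕ, (-1 : ℝ) ^ k * (Real.pi ^ (2 * k) *
          (((eulerPolynomial (2 * k + 1)).eval 1 : ℚ) : ℝ)) /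
            ((2 * k + 2 * m + 3).factorial : ℝ) := by
  have hpi := Real.pi_ne_zero
  have hf := Nat.factorial_ne_zero (2 * m + 1)
  rw [(hasSum_eulerPolynomial_integral m).tsum_eq, integral_tan_mul_one_sub_pow,
    integral_cot_eq_sum m hL]
  have hc : ∀ S : ℝ, (-1) ^ m * Real.pi ^ (2 * m + 2) / 2 *
      (2 * ((2 * m + 1).factorial * S) / (Real.pi * (2 * m + 1).factorial)) =
      ((-1) ^ m * Real.pi ^ (2 * m + 1)) * S := fun S => by
    rw [pow_succ Real.pi (2 * m + 1)]; field_simp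
  rw [hc, Finset.mul_sum]
  refine Finset.sum_congr rfl fun j hj => ?_
  obtain ⟨i, rfl⟩ := Nat.exists_eq_add_of_le (Nat.lt_succ_iff.1 (Finset.mem_range.1 hj))
  rw [Nat.add_sub_cancel_left, pow_add (-1 : ℝ),
    show 2 * (j + i) + 1 = 2 * j + (2 * i + 1) by ring, pow_add Real.pi (2 * j)]
  have hi : (-1 : ℝ) ^ i * (-1) ^ i = 1 := by rw [← mul_pow]; norm_num
  have hp : Real.pi ^ (2 * i + 1) ≠ 0 := pow_ne_zero _ hpi
  have hj : ((2 * j + 1).factorial : ℝ) ≠ 0 := by positivity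
  field_simp
  linear_combination (-L i) * hi

theorem theorem3 (m : ℕ) (hm : 0 < m) :
    Summable (fun k : ℕ => (-1 : ℂ) ^ k *
      ((Real.pi : ℂ) ^ (2 * k) * (((eulerPolynomial (2 * k + 1)).eval 1 : ℚ) : ℂ) /
        ((2 * k + 2 * m + 3).factorial : ℂ))) ∧
    (1 - (2 : ℂ) ^ (-(2 * (m : ℤ)))) * riemannZeta (2 * (m : ℂ) + 1) =
      ∑ j ∈ Finset.Ico 1 m,
          (-1 : ℂ) ^ j * (Real.pi : ℂ) ^ (2 * j) / ((2 * j + 1).factorial : ℂ) *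
            ((2 : ℂ) ^ (2 * (j : ℤ) - 2 * (m : ℤ)) - 1) *
            riemannZeta (2 * (m : ℂ) - 2 * (j : ℂ) + 1)
        - (-1 : ℂ) ^ m * (Real.pi : ℂ) ^ (2 * m) * (Real.log 2 : ℂ) / ((2 * m + 1).factorial : ℂ)
        + (-1 : ℂ) ^ m * (Real.pi : ℂ) ^ (2 * m + 2) / 2 *
          ∑' k : ℕ, (-1 : ℂ) ^ k *
            ((Real.pi : ℂ) ^ (2 * k) * (((eulerPolynomial (2 * k + 1)).eval 1 : ℚ) : ℂ) /
              ((2 * k + 2 * m + 3).factorial : ℂ)) := by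
  let L : ℕ → ℝ := fun i => if i = 0 then Real.log 2 else
    (1 - 2 / 2 ^ (2 * i + 1)) * ∑' n : ℕ, 1 / ((n : ℝ) + 1) ^ (2 * i + 1)
  have hL : ∀ i, Filter.Tendsto (fun K : ℕ => ∑ n ∈ Finset.range (2 * K),
      (-1 : ℝ) ^ n / ((n : ℝ) + 1) ^ (2 * i + 1)) Filter.atTop (nhds (L i)) := by
    intro i
    rcases eq_or_ne i 0 with rfl | hi
    · simpa [L] using tendsto_sum_neg_one_pow_div_log_two
    · simp only [L, hi, if_false]
      exact (hasSum_neg_one_pow_div_pow (by omega)).tendsto_sum_nat.comp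
        (Filter.tendsto_id.const_mul_atTop' two_pos)
  have hLz : ∀ i : ℕ, i ≠ 0 →
      (L i : ℂ) = (1 - 1 / (2 : ℂ) ^ (2 * i)) * riemannZeta ((2 * i + 1 : ℕ) : ℂ) := by
    intro i hi
    rw [riemannZeta_natCast_eq_ofReal_tsum (by omega)]
    simp only [L, hi, if_false]
    rw [Complex.ofReal_mul]
    congr 1
    push_cast
    rw [pow_succ]
    field_simp
  have hterm : (fun k : ℕ => (-1 : ℂ) ^ k *
      ((Real.pi : ℂ) ^ (2 * k) * (((eulerPolynomial (2 * k + 1)).eval 1 : ℚ) : ℂ) /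
        ((2 * k + 2 * m + 3).factorial : ℂ))) = fun k : ℕ =>
      (((-1 : ℝ) ^ k * (Real.pi ^ (2 * k) * (((eulerPolynomial (2 * k + 1)).eval 1 : ℚ) : ℝ)) /
        ((2 * k + 2 * m + 3).factorial : ℝ) : ℝ) : ℂ) := by
    ext k; push_cast; ring
  rw [hterm]
  refine ⟨Complex.ofRealCLM.summable (summable_eulerPolynomial_div_factorial m).of_abs, ?_⟩
  rw [← Complex.ofReal_tsum]
  have h := congrArg (fun x : ℝ => (x : ℂ)) (sum_alternatingZeta_eq_tsum_eulerPolynomial m hL)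
  -- The term j = m carries ln 2 and the term j = 0 carries ζ(2m+1); both are split off.
  rw [Finset.sum_range_succ, Finset.range_eq_Ico, Finset.sum_eq_sum_Ico_succ_bot hm, Nat.sub_self,
    Nat.sub_zero, Complex.ofReal_mul (_ / 2)] at h
  rw [Complex.ofReal_add, Complex.ofReal_add, Complex.ofReal_mul _ (L m), hLz m hm.ne'] at h
  have hL0 : L 0 = Real.log 2 := by simp [L]
  rw [hL0] at h
  -- The minus sign comes from 2^(2j-2m) - 1 = -(1 - 2^(-2(m-j))).
  have hsum : ∑ j ∈ Finset.Ico 1 m,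
          (-1 : ℂ) ^ j * (Real.pi : ℂ) ^ (2 * j) / ((2 * j + 1).factorial : ℂ) *
            ((2 : ℂ) ^ (2 * (j : ℤ) - 2 * (m : ℤ)) - 1) *
            riemannZeta (2 * (m : ℂ) - 2 * (j : ℂ) + 1) =
      -((∑ j ∈ Finset.Ico (0 + 1) m,
        (-1) ^ j * Real.pi ^ (2 * j) / ((2 * j + 1).factorial : ℝ) * L (m - j) : ℝ) : ℂ) := by
    rw [Complex.ofReal_sum, ← Finset.sum_neg_distrib]
    refine Finset.sum_congr rfl fun j hj => ?_
    obtain ⟨i, rfl⟩ := Nat.exists_eq_add_of_lt (Finset.mem_Ico.1 hj).2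
    rw [show j + i + 1 - j = i + 1 by omega, Complex.ofReal_mul, hLz (i + 1) (by omega),
      show 2 * (j : ℤ) - 2 * ((j + i + 1 : ℕ) : ℤ) = -((2 * (i + 1) : ℕ) : ℤ) by push_cast; ring,
      show 2 * ((j + i + 1 : ℕ) : ℂ) - 2 * (j : ℂ) + 1 = ((2 * (i + 1) + 1 : ℕ) : ℂ) by
        push_cast; ring, zpow_neg, zpow_natCast]
    push_cast
    ring
  rw [hsum, show -(2 * (m : ℤ)) = -((2 * m : ℕ) : ℤ) by push_cast; ring, zpow_neg, zpow_natCast,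
    show 2 * (m : ℂ) + 1 = ((2 * m + 1 : ℕ) : ℂ) by push_cast; ring]
  push_cast at h ⊢
  simp only [pow_zero, Nat.factorial_one, Nat.cast_one, mul_one, div_one,
    one_mul] at h ⊢
  linear_combination h
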